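/- Let $p$ be a prime and let $G$ be a finite $p$-group of nilpotency class exactly $2$. Let $\operatorname{Aut}_c(G)$ be the group of class preserving automorphisms of $G$, i.e. the automorphisms $\alpha$ such that $\alpha(x)$ is conjugate to $x$ in $G$ for every $x\in G$, and let $\operatorname{Autcent}(G)$ be the group of central automorphisms of $G$, i.e. the automorphisms $\phi$ such that $g^{-1}\phi(g)\in Z(G)$ for every $g\in G$. If $\operatorname{Aut}_c(G)=\operatorname{Autcent}(G)$, then the minimal number of generators $d(G)$ of $G$ is even. -/

import Mathlib

/-- The subgroup of central automorphisms of `G`: those `φ` such that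
`g⁻¹ * φ g` lies in the center of `G` for every `g`. -/
def Autcent (G : Type*) [Group G] : Subgroup (MulAut G) where
  carrier := {φ | ∀ g : G, g⁻¹ * φ g ∈ Subgroup.center G}
  one_mem' g := by simp
  mul_mem' {φ ψ} hφ hψ g := by
    have h := Subgroup.mul_mem _ (hψ g) (hφ (ψ g))
    simpa [mul_assoc] using h
  inv_mem' {φ} hφ g := by
    have h := Subgroup.inv_mem _ (hφ (φ⁻¹ g))
    simpa using h

/-- The subgroup of class preserving automorphisms of `G`: those `φ` such that
`φ g` is conjugate to `g` for every `g`. -/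
def AutClassPreserving (G : Type*) [Group G] : Subgroup (MulAut G) where
  carrier := {φ | ∀ g : G, φ g ∈ conjugatesOf g}
  one_mem' g := by simp [mem_conjugatesOf_self]
  mul_mem' {φ ψ} hφ hψ g := IsConj.trans (hψ g) (hφ (ψ g))
  inv_mem' {φ} hφ g := by
    have h : IsConj (φ⁻¹ g) (φ (φ⁻¹ g)) := hφ (φ⁻¹ g)
    rw [MulAut.apply_inv_self] at h
    exact h.symm

/-! If `f : G →* G` is central-valued and `f ∘ f` is trivial, then `g ↦ g * f g` is a central
automorphism, hence class preserving, so every `f g` is a commutator `⁅g⁻¹, h⁆`. Let `u` in the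
derived subgroup have order its exponent, a multiple of the exponent of `G ⧸ center G`.
Homomorphisms from that quotient to `⟨u⟩` separate points, so each noncentral `x` has a nontrivial
commutator `⁅x, y⁆` in `⟨u⟩`. For a character `χ` of the center faithful on `⟨u⟩`, the alternating
pairing `χ ⁅x, y⁆` on `G ⧸ center G` is therefore nondegenerate (`exists_commutator_apply_ne_one`).
Splitting off hyperbolic pairs shows that this quotient has even rank (`even_rank_of_alternating`).
Maps from `G ⧸ M` to `⟨u⟩`, with `M` maximal, give `center_le_frattini`, so `G` has the same rank.
-/

open Subgroup
open scoped commutatorElement IsMulCommutative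

/-! ### Alternating pairings on finite abelian `p`-groups -/

section Symplectic

variable {A : Type*} [CommGroup A] (B : A →* A →* ℂˣ)

theorem MonoidHom.apply_swap_of_alternating (halt : ∀ x, B x x = 1) (x y : A) :
    B y x = (B x y)⁻¹ := by
  have h := halt (x * y)
  simp only [map_mul, MonoidHom.mul_apply, halt, one_mul, mul_one] at h
  exact eq_inv_of_mul_eq_one_left h

/-- A nontrivial finite abelian `p`-group with a nondegenerate pairing contains a pair of elements
whose pairing has the largest conceivable order. -/
theorem exists_orderOf_apply_eq_exponent [Finite A] [Nontrivial A] {p : ℕ} [Fact p.Prime]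
    (hA : IsPGroup p A) (hnd : ∀ x, x ≠ 1 → ∃ y, B x y ≠ 1) :
    ∃ (a : ℕ) (x y : A), Monoid.exponent A = p ^ (a + 1) ∧ orderOf (B x y) = p ^ (a + 1) := by
  obtain ⟨x, hx⟩ := Monoid.exists_orderOf_eq_exponent (Monoid.ExponentExists.of_finite (G := A))
  obtain ⟨n, hn⟩ := IsPGroup.iff_orderOf.mp hA x
  obtain _ | a := n
  · rw [pow_zero, hx, Monoid.exp_eq_one_iff] at hn
    exact absurd hn (not_subsingleton A)
  have hne : x ^ p ^ a ≠ 1 := by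
    intro h
    have h1 := orderOf_dvd_of_pow_eq_one h
    rw [hn, Nat.pow_dvd_pow_iff_le_right (Fact.out : p.Prime).one_lt] at h1
    omega
  -- Nondegeneracy at `x ^ p ^ a` gives `B x y ^ p ^ a ≠ 1`, which forces the full order.
  obtain ⟨y, hy⟩ := hnd _ hne
  refine ⟨a, x, y, hx ▸ hn, orderOf_eq_prime_pow ?_ ?_⟩
  · rwa [map_pow, MonoidHom.pow_apply] at hy
  · rw [← MonoidHom.pow_apply, ← map_pow, ← hn, pow_orderOf_eq_one, map_one, MonoidHom.one_apply]

/-- If `B x y` has order the exponent of `A`, then `A` is generated by `x`, `y` and the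
orthogonal complement of `{x, y}`. -/
theorem exists_mul_mem_orthogonal [Finite A] (halt : ∀ x, B x x = 1) {x y : A}
    (hxy : orderOf (B x y) = Monoid.exponent A) (g : A) :
    ∃ i j : ℕ, g * (x ^ i * y ^ j) ∈ (B x).ker ⊓ (B y).ker := by
  have : NeZero (Monoid.exponent A) := ⟨Monoid.exponent_ne_zero_of_finite⟩
  have hp : IsPrimitiveRoot (B x y) (Monoid.exponent A) := hxy ▸ IsPrimitiveRoot.orderOf _
  have hroot : ∀ h : A, (B h g)⁻¹ ∈ rootsOfUnity (Monoid.exponent A) ℂ := fun h ↦ by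
    rw [mem_rootsOfUnity, inv_pow, ← map_pow, Monoid.pow_exponent_eq_one, map_one, inv_one]
  obtain ⟨j, -, hj⟩ := hp.eq_pow_of_mem_rootsOfUnity (hroot x)
  obtain ⟨i, -, hi⟩ := hp.inv.eq_pow_of_mem_rootsOfUnity (hroot y)
  refine ⟨i, j, mem_inf.2 ⟨?_, ?_⟩⟩ <;>
    rw [MonoidHom.mem_ker, map_mul, map_mul, map_pow, map_pow, halt]
  · rw [hj, one_pow, one_mul, mul_inv_cancel]
  · rw [B.apply_swap_of_alternating halt x y, hi, one_pow, mul_one, mul_inv_cancel]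

/-- Passing to the orthogonal complement of a hyperbolic pair divides the number of elements of
order dividing `p` by `p ^ 2`. -/
theorem card_ker_pow_eq_sq_mul_card_orthogonal [Finite A] {p a : ℕ} [Fact p.Prime]
    (halt : ∀ x, B x x = 1) {x y : A} (hexp : Monoid.exponent A = p ^ (a + 1))
    (hxy : orderOf (B x y) = p ^ (a + 1)) :
    Nat.card (powMonoidHom p : A →* A).ker = p ^ 2 *
      Nat.card (powMonoidHom p : ↥((B x).ker ⊓ (B y).ker) →* ↥((B x).ker ⊓ (B y).ker)).ker := by
  have hp0 : NeZero p := ⟨(Fact.out : p.Prime).ne_zero⟩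
  have hroot : ∀ (h : A) (z : (powMonoidHom p : A →* A).ker), B h z ∈ rootsOfUnity p ℂ := by
    rintro h ⟨z, hz⟩
    rw [MonoidHom.mem_ker, powMonoidHom_apply] at hz
    rw [mem_rootsOfUnity, ← map_pow, hz, map_one]
  -- `T` pairs the `p`-torsion with `x` and `y`. It is onto already on the products of powers of `x
  -- ^ p ^ a` and `y ^ p ^ a`, and its kernel is the `p`-torsion of the complement.
  let T : (powMonoidHom p : A →* A).ker →* rootsOfUnity p ℂ × rootsOfUnity p ℂ :=
    (((B x).comp (Subgroup.subtype _)).codRestrict _ (hroot x)).prod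
      (((B y).comp (Subgroup.subtype _)).codRestrict _ (hroot y))
  have hprim : IsPrimitiveRoot (B x y ^ p ^ a) p :=
    (hxy ▸ IsPrimitiveRoot.orderOf (B x y)).pow (pow_pos hp0.pos _) (pow_succ p a)
  have hpow : ∀ (g : A) (i : ℕ), (g ^ p ^ a) ^ i ∈ (powMonoidHom p : A →* A).ker := fun g i ↦ by
    rw [MonoidHom.mem_ker, powMonoidHom_apply, ← pow_mul, mul_comm, pow_mul, ← pow_mul g,
      ← pow_succ, ← hexp, Monoid.pow_exponent_eq_one, one_pow]
  have hT : Function.Surjective T := by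
    rintro ⟨⟨ζ, hζ⟩, ⟨η, hη⟩⟩
    obtain ⟨j, -, rfl⟩ := hprim.eq_pow_of_mem_rootsOfUnity hζ
    obtain ⟨i, -, rfl⟩ := hprim.inv.eq_pow_of_mem_rootsOfUnity hη
    refine ⟨⟨_, mul_mem (hpow x i) (hpow y j)⟩, ?_⟩
    refine Prod.ext (Subtype.ext ?_) (Subtype.ext ?_)
    · change B x ((x ^ p ^ a) ^ i * (y ^ p ^ a) ^ j) = _
      simp [halt]
    · change B y ((x ^ p ^ a) ^ i * (y ^ p ^ a) ^ j) = _
      simp [halt, B.apply_swap_of_alternating halt x y]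
  have hker : Nat.card T.ker = Nat.card
      (powMonoidHom p : ↥((B x).ker ⊓ (B y).ker) →* ↥((B x).ker ⊓ (B y).ker)).ker := by
    have hmem : ∀ z, z ∈ T.ker ↔ B x z = 1 ∧ B y z = 1 := fun z ↦ by
      rw [MonoidHom.mem_ker, Prod.ext_iff, Subtype.ext_iff, Subtype.ext_iff]
      rfl
    refine Nat.card_congr
      { toFun := fun z ↦ ⟨⟨z.1.1, (hmem _).1 z.2⟩, Subtype.ext z.1.2⟩
        invFun := fun z ↦ ⟨⟨z.1.1, congrArg Subtype.val z.2⟩, (hmem _).2 z.1.2⟩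
        left_inv := fun _ ↦ rfl
        right_inv := fun _ ↦ rfl }
  rw [Subgroup.card_eq_card_quotient_mul_card_subgroup T.ker, hker,
    Nat.card_congr (QuotientGroup.quotientKerEquivOfSurjective T hT).toEquiv, Nat.card_prod,
    HasEnoughRootsOfUnity.natCard_rootsOfUnity ℂ p, sq]

/-- Induction on the order: the orthogonal complement of a hyperbolic pair is smaller, inherits a
nondegenerate pairing, and loses exactly a factor `p ^ 2` of `p`-torsion. -/
theorem exists_card_ker_pow_eq_of_alternating {p : ℕ} [Fact p.Prime] (n : ℕ) :
    ∀ {A : Type*} [CommGroup A] [Finite A] (B : A →* A →* ℂˣ), Nat.card A = n → IsPGroup p A →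
      (∀ x, B x x = 1) → (∀ x, x ≠ 1 → ∃ y, B x y ≠ 1) →
      ∃ k, Nat.card (powMonoidHom p : A →* A).ker = p ^ (2 * k) := by
  induction n using Nat.strong_induction_on with
  | _ n ih =>
  intro A _ _ B hn hA halt hnd
  obtain hsub | hnontriv := subsingleton_or_nontrivial A
  · exact ⟨0, by simp⟩
  obtain ⟨a, x, y, hexp, hxy⟩ := exists_orderOf_apply_eq_exponent B hA hnd
  have hone : B x y ≠ 1 := fun h ↦ by
    rw [h, orderOf_one] at hxy
    exact (Nat.one_lt_pow a.succ_ne_zero (Fact.out : p.Prime).one_lt).ne hxy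
  have hlt : Nat.card ↥((B x).ker ⊓ (B y).ker) < n := by
    rw [← hn]
    refine lt_of_le_of_ne (Subgroup.card_le_card_group _) fun h ↦ hone ?_
    have := Subgroup.eq_top_of_card_eq _ h
    exact (this ▸ mem_top y : y ∈ (B x).ker ⊓ (B y).ker).1
  let B' : ↥((B x).ker ⊓ (B y).ker) →* ↥((B x).ker ⊓ (B y).ker) →* ℂˣ :=
    (MonoidHom.compHom' (Subgroup.subtype _)).comp (B.comp (Subgroup.subtype _))
  obtain ⟨k, hk⟩ := ih _ hlt B' rfl (hA.to_subgroup _) (fun z ↦ halt z) fun z hz ↦ by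
    obtain ⟨g, hg⟩ := hnd z (fun h ↦ hz (Subtype.ext h))
    -- Moving `g` into the complement does not change `B z g`, since `z` is orthogonal to `x` and
    -- `y`.
    obtain ⟨i, j, hij⟩ := exists_mul_mem_orthogonal B halt (hxy.trans hexp.symm) g
    refine ⟨⟨_, hij⟩, ?_⟩
    change B z (g * (x ^ i * y ^ j)) ≠ 1
    have hzx : B z x = 1 := by
      rw [B.apply_swap_of_alternating halt x z, show B x z = 1 from z.2.1, inv_one]
    have hzy : B z y = 1 := by
      rw [B.apply_swap_of_alternating halt y z, show B y z = 1 from z.2.2, inv_one]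
    rwa [map_mul, map_mul, map_pow, map_pow, hzx, hzy, one_pow, one_pow, mul_one, mul_one]
  refine ⟨k + 1, ?_⟩
  rw [card_ker_pow_eq_sq_mul_card_orthogonal B halt hexp hxy, hk]
  ring

end Symplectic

/-! ### Frattini subgroup and maximal subgroups -/

section Frattini

variable {G : Type*} [Group G] [Finite G]

/-- Lifts of generators of the quotient generate `G` together with `N`, and `N` consists of
nongenerators. -/
theorem rank_quotient_eq_of_le_frattini (N : Subgroup G) [N.Normal] (hN : N ≤ frattini G) :
    Group.rank (G ⧸ N) = Group.rank G := by
  classical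
  refine le_antisymm (Group.rank_le_of_surjective (QuotientGroup.mk' N)
    (QuotientGroup.mk'_surjective N)) ?_
  obtain ⟨S, hS, hcl⟩ := Group.rank_spec (G ⧸ N)
  rw [← hS]
  refine le_trans (Group.rank_le (S := S.image Quotient.out) ?_) Finset.card_image_le
  refine frattini_nongenerating (top_le_iff.1 (le_trans ?_ (sup_le_sup_left hN _)))
  have hmap : (closure ((S.image Quotient.out : Finset G) : Set G)).map (QuotientGroup.mk' N)
      = ⊤ := by
    rw [MonoidHom.map_closure, Finset.coe_image, Set.image_image]
    simpa using hcl
  have hsup := comap_map_eq (QuotientGroup.mk' N)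
    (closure ((S.image Quotient.out : Finset G) : Set G))
  rw [hmap, comap_top, QuotientGroup.ker_mk'] at hsup
  exact hsup.le

variable {p : ℕ} [Fact p.Prime]

/-- A maximal subgroup of a finite `p`-group is normal. -/
theorem IsPGroup.normal_of_isCoatom (hG : IsPGroup p G) {M : Subgroup G} (hM : IsCoatom M) :
    M.Normal := by
  have := hG.isNilpotent
  exact Group.normalizerCondition_of_isNilpotent.normal_of_coatom M hM

/-- A maximal subgroup of a finite `p`-group has index `p`. -/
theorem IsPGroup.card_quotient_of_isCoatom (hG : IsPGroup p G) {M : Subgroup G} [M.Normal]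
    (hM : IsCoatom M) : Nat.card (G ⧸ M) = p := by
  have hQ : IsPGroup p (G ⧸ M) := hG.to_quotient M
  have : Group.IsNilpotent (G ⧸ M) := hQ.isNilpotent
  have : Nontrivial (G ⧸ M) := QuotientGroup.nontrivial_iff.2 hM.1
  have : IsSimpleGroup (G ⧸ M) := ⟨fun H _ ↦ by
    have hinj := comap_injective (QuotientGroup.mk'_surjective M)
    have hle : M ≤ H.comap (QuotientGroup.mk' M) := by
      conv_lhs => rw [← QuotientGroup.ker_mk' M]
      exact MonoidHom.ker_le_comap _ _
    obtain h | h := hM.le_iff.1 hle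
    · exact .inr (hinj (h.trans (comap_top _).symm))
    · refine .inl (hinj (h.trans ?_))
      rw [MonoidHom.comap_bot, QuotientGroup.ker_mk']⟩
  have hprime : (Nat.card (G ⧸ M)).Prime := IsSimpleGroup.prime_card
  obtain ⟨n, hn⟩ := IsPGroup.iff_card.1 hQ
  rw [hn] at hprime
  rw [hn, hprime.eq_one_of_pow, pow_one]

theorem IsPGroup.pow_mem_of_isCoatom (hG : IsPGroup p G) {M : Subgroup G} (hM : IsCoatom M)
    (g : G) : g ^ p ∈ M := by
  have := hG.normal_of_isCoatom hM
  rw [← QuotientGroup.eq_one_iff, QuotientGroup.mk_pow, ← hG.card_quotient_of_isCoatom hM,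
    pow_card_eq_one']

theorem IsPGroup.commutator_le_of_isCoatom (hG : IsPGroup p G) {M : Subgroup G} (hM : IsCoatom M) :
    commutator G ≤ M := by
  have := hG.normal_of_isCoatom hM
  have : IsCyclic (G ⧸ M) := isCyclic_of_prime_card (hG.card_quotient_of_isCoatom hM)
  exact Normal.quotient_commutative_iff_commutator_le.1 inferInstance

end Frattini

/-! ### Rank of an abelian `p`-group via its `p`-torsion -/

section Rank

variable {p : ℕ} [Fact p.Prime]

/-- A finite vector space over `ZMod p` of dimension `d` is generated as a group by `d` elements. -/
theorem exists_finset_closure_eq_top_of_zmod_module (W : Type*) [AddCommGroup W] [Finite W]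
    [Module (ZMod p) W] :
    ∃ S : Finset W, AddSubgroup.closure (S : Set W) = ⊤ ∧ p ^ S.card ≤ Nat.card W := by
  classical
  let b := Module.finBasis (ZMod p) W
  refine ⟨Finset.univ.image b, top_le_iff.1 fun v _ ↦ ?_, ?_⟩
  · have hv : v ∈ Submodule.span (ZMod p) (Set.range b) := b.span_eq ▸ Submodule.mem_top
    refine Submodule.span_induction (p := fun w _ ↦ w ∈ AddSubgroup.closure _) ?_ (zero_mem _)
      (fun _ _ _ _ h₁ h₂ ↦ add_mem h₁ h₂) (fun c w _ hw ↦ ?_) hv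
    · rintro _ ⟨i, rfl⟩
      exact AddSubgroup.subset_closure (by simp)
    · rw [← ZMod.natCast_zmod_val c, Nat.cast_smul_eq_nsmul]
      exact nsmul_mem hw _
  · rw [← FiniteField.pow_finrank_eq_natCard p W]
    exact Nat.pow_le_pow_right (Fact.out : p.Prime).pos (Finset.card_image_le.trans (by simp))

theorem card_eq_pow_rank_of_pow_eq_one {V : Type*} [CommGroup V] [Finite V]
    (hV : ∀ v : V, v ^ p = 1) : Nat.card V = p ^ Group.rank V := by
  have hp : 0 < p := (Fact.out : p.Prime).pos
  refine le_antisymm (Nat.le_of_dvd (pow_pos hp _) (card_dvd_exponent_pow_rank' V hV)) ?_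
  obtain ⟨S, hS, hcard⟩ := @exists_finset_closure_eq_top_of_zmod_module p _ (Additive V) _
    ‹Finite V› (AddCommGroup.zmodModule fun v ↦ congrArg Additive.ofMul (hV v.toMul))
  refine le_trans (Nat.pow_le_pow_right hp
    (Group.rank_le (S := S.map Additive.toMul.toEmbedding) ?_)) ?_
  · have := congrArg AddSubgroup.toSubgroup' hS
    rw [AddSubgroup.toSubgroup'_closure] at this
    rw [Finset.coe_map]
    convert! this using 2
    ext x
    simp
  · rwa [Finset.card_map]

/-- The `p`-torsion has as many elements as the quotient by `p`-th powers; that quotient is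
elementary abelian, and its rank is that of `A` because `p`-th powers lie in the Frattini subgroup.
-/
theorem IsPGroup.card_ker_pow_eq_pow_rank {A : Type*} [CommGroup A] [Finite A]
    (hA : IsPGroup p A) : Nat.card (powMonoidHom p : A →* A).ker = p ^ Group.rank A := by
  have hle : (powMonoidHom p : A →* A).range ≤ frattini A := by
    rintro _ ⟨g, rfl⟩
    simp only [frattini, Order.radical, mem_iInf]
    exact fun M hM ↦ hA.pow_mem_of_isCoatom hM g
  rw [← index_range, index_eq_card, ← rank_quotient_eq_of_le_frattini _ hle]
  refine card_eq_pow_rank_of_pow_eq_one fun v ↦ ?_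
  induction v using QuotientGroup.induction_on with
  | _ g => exact (QuotientGroup.eq_one_iff _).2 ⟨g, rfl⟩

theorem even_rank_of_alternating {A : Type*} [CommGroup A] [Finite A] (hA : IsPGroup p A)
    (B : A →* A →* ℂˣ) (halt : ∀ x, B x x = 1) (hnd : ∀ x, x ≠ 1 → ∃ y, B x y ≠ 1) :
    Even (Group.rank A) := by
  obtain ⟨k, hk⟩ := exists_card_ker_pow_eq_of_alternating _ B rfl hA halt hnd
  rw [hA.card_ker_pow_eq_pow_rank] at hk
  rw [Nat.pow_right_injective (Fact.out : p.Prime).two_le hk]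
  exact even_two_mul k

end Rank

/-! ### Central automorphisms built from homomorphisms -/

section CentralAutomorphism

variable {G : Type*} [Group G]

/-- A homomorphism `f` from `G` to its center with `f ∘ f = 1` yields the central automorphism
`g ↦ g * f g`. -/
theorem exists_mem_autcent_of_hom (f : G →* G) (hf : ∀ g, f g ∈ center G)
    (hff : ∀ g, f (f g) = 1) : ∃ φ ∈ Autcent G, ∀ g, φ g = g * f g := by
  let φ : MulAut G :=
    { toFun := fun g ↦ g * f g
      invFun := fun g ↦ g * (f g)⁻¹
      left_inv := fun g ↦ by simp [hff]
      right_inv := fun g ↦ by simp [hff]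
      map_mul' := fun g h ↦ by
        rw [map_mul, mul_assoc, mul_assoc, ← mul_assoc h, mem_center_iff.1 (hf g), mul_assoc] }
  refine ⟨φ, fun g ↦ ?_, fun _ ↦ rfl⟩
  rw [show φ g = g * f g from rfl, inv_mul_cancel_left]
  exact hf g

theorem exists_eq_commutatorElement_of_hom (hA : AutClassPreserving G = Autcent G) (f : G →* G)
    (hf : ∀ g, f g ∈ center G) (hff : ∀ g, f (f g) = 1) (g : G) : ∃ h, f g = ⁅g⁻¹, h⁆ := by
  obtain ⟨φ, hφ, hφf⟩ := exists_mem_autcent_of_hom f hf hff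
  rw [← hA] at hφ
  obtain ⟨h, hh⟩ := isConj_iff.1 (hφ g : IsConj g (φ g))
  refine ⟨h, ?_⟩
  rw [hφf] at hh
  rw [commutatorElement_def, inv_inv, eq_comm, ← inv_mul_eq_iff_eq_mul.2 hh]
  group

/-- A cyclic group of order a multiple of the exponent of a finite abelian quotient `G ⧸ N`
separates the points of that quotient. -/
theorem exists_hom_zpowers_apply_ne_one [Finite G] {N : Subgroup G} [N.Normal]
    (hN : commutator G ≤ N) {u : G} (hu : Monoid.exponent (G ⧸ N) ∣ orderOf u) {g : G}
    (hg : g ∉ N) : ∃ f : G →* G, (∀ x, f x ∈ zpowers u) ∧ (∀ x ∈ N, f x = 1) ∧ f g ≠ 1 := by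
  let _ : CommGroup (G ⧸ N) :=
    { mul_comm := (Normal.quotient_commutative_iff_commutator_le.2 hN).is_comm.comm }
  have : NeZero (orderOf u) := ⟨(orderOf_pos u).ne'⟩
  -- The group `⟨u⟩` serves as its own roots of unity, so character duality applies with values in
  -- it.
  have : HasEnoughRootsOfUnity (zpowers u) (orderOf u) :=
    { prim := ⟨⟨u, mem_zpowers u⟩, by
        rw [← Subgroup.orderOf_mk u (mem_zpowers u)]; exact IsPrimitiveRoot.orderOf _⟩
      cyc := by
        have : IsCyclic (zpowers u)ˣ :=
          isCyclic_of_surjective (toUnits (G := zpowers u)) toUnits.surjective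
        infer_instance }
  have := HasEnoughRootsOfUnity.of_dvd (zpowers u) hu
  obtain ⟨φ, hφ⟩ := CommGroup.exists_apply_ne_one_of_hasEnoughRootsOfUnity (G ⧸ N) (zpowers u)
    (a := (g : G ⧸ N)) (by rwa [ne_eq, QuotientGroup.eq_one_iff])
  refine ⟨(zpowers u).subtype.comp ((Units.coeHom _).comp (φ.comp (QuotientGroup.mk' N))),
    fun x ↦ SetLike.coe_mem _, fun x hx ↦ ?_, fun h ↦ hφ ?_⟩
  · have : (QuotientGroup.mk' N) x = 1 := (QuotientGroup.eq_one_iff x).2 hx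
    simp only [MonoidHom.comp_apply, this, map_one]
  · exact Units.ext (Subtype.ext h)

end CentralAutomorphism

/-! ### Commutator pairing in class two -/

section ClassTwo

variable {G : Type*} [Group G]

theorem commutator_le_center_of_nilpotencyClass_le_two [Group.IsNilpotent G]
    (h : Group.nilpotencyClass G ≤ 2) : commutator G ≤ center G := by
  rw [← Subgroup.upperCentralSeries_eq_top_iff_nilpotencyClass_le] at h
  rw [commutator_def, commutator_le]
  intro g _ x _
  have hg : g ∈ Subgroup.upperCentralSeries G (1 + 1) := h ▸ mem_top g
  rw [Subgroup.mem_upperCentralSeries_succ_iff, Subgroup.upperCentralSeries_one] at hg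
  exact hg x

theorem commutatorElement_mem_commutator (x y : G) : ⁅x, y⁆ ∈ commutator G :=
  commutator_mem_commutator (mem_top x) (mem_top y)

theorem commutatorElement_mul_right_of_le_center (hc : commutator G ≤ center G) (x y z : G) :
    ⁅x, y * z⁆ = ⁅x, y⁆ * ⁅x, z⁆ := by
  have h : ⁅x, z⁆ ∈ center G := hc (commutatorElement_mem_commutator x z)
  have h₁ : ⁅x, y * z⁆ = ⁅x, y⁆ * (y * ⁅x, z⁆ * y⁻¹) := by
    simp only [commutatorElement_def]; group
  rw [h₁, mem_center_iff.1 h y, mul_inv_cancel_right]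

theorem commutatorElement_mul_left_of_le_center (hc : commutator G ≤ center G) (x y z : G) :
    ⁅x * y, z⁆ = ⁅x, z⁆ * ⁅y, z⁆ := by
  have h : ⁅y, z⁆ ∈ center G := hc (commutatorElement_mem_commutator y z)
  have h₁ : ⁅x * y, z⁆ = x * ⁅y, z⁆ * x⁻¹ * ⁅x, z⁆ := by
    simp only [commutatorElement_def]; group
  rw [h₁, mem_center_iff.1 h x, mul_inv_cancel_right, mem_center_iff.1 h]

/-- The commutator pairing of a group of class two, with values in the derived subgroup. -/
def commutatorPairing (hc : commutator G ≤ center G) (x : G) : G →* commutator G where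
  toFun y := ⟨⁅x, y⁆, commutatorElement_mem_commutator x y⟩
  map_one' := Subtype.ext (commutatorElement_one_right x)
  map_mul' y z := Subtype.ext (commutatorElement_mul_right_of_le_center hc x y z)

/-- By linearity `⁅x, g ^ e⁆ = ⁅x, g⁆ ^ e`, which is trivial when `e` is the exponent of the derived
subgroup. -/
theorem exponent_quotient_center_dvd (hc : commutator G ≤ center G) :
    Monoid.exponent (G ⧸ center G) ∣ Monoid.exponent (commutator G) := by
  refine Monoid.exponent_dvd_of_forall_pow_eq_one fun v ↦ ?_
  induction v using QuotientGroup.induction_on with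
  | _ g =>
  rw [← QuotientGroup.mk_pow, QuotientGroup.eq_one_iff, mem_center_iff]
  intro x
  have h : commutatorPairing hc x (g ^ Monoid.exponent (commutator G)) = 1 := by
    rw [map_pow, Monoid.pow_exponent_eq_one]
  exact commutatorElement_eq_one_iff_mul_comm.1 (congrArg Subtype.val h)

/-- The pairing on `G ⧸ center G` obtained by composing the commutator with a character of the
center. -/
theorem exists_pairing_quotient_center (hc : commutator G ≤ center G) (χ : center G →* ℂˣ) :
    ∃ B : G ⧸ center G →* G ⧸ center G →* ℂˣ, ∀ x y : G,
      B x y = χ ⟨⁅x, y⁆, hc (commutatorElement_mem_commutator x y)⟩ := by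
  let b (x : G) : G ⧸ center G →* ℂˣ :=
    QuotientGroup.lift (center G) ((χ.comp (inclusion hc)).comp (commutatorPairing hc x))
      fun y hy ↦ by
        have : commutatorPairing hc x y = 1 :=
          Subtype.ext (commutatorElement_eq_one_iff_mul_comm.2 (mem_center_iff.1 hy x))
        rw [MonoidHom.mem_ker, MonoidHom.comp_apply, this, map_one]
  have hb : ∀ x y : G, b x y =
      χ ⟨⁅x, y⁆, hc (commutatorElement_mem_commutator x y)⟩ := fun _ _ ↦ rfl
  refine ⟨QuotientGroup.lift (center G) (MonoidHom.mk' b fun x y ↦ ?_) fun x hx ↦ ?_, hb⟩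
  · refine MonoidHom.ext fun z ↦ ?_
    induction z using QuotientGroup.induction_on with
    | _ z =>
    rw [MonoidHom.mul_apply, hb, hb, hb, ← map_mul]
    exact congrArg χ (Subtype.ext (commutatorElement_mul_left_of_le_center hc x y z))
  · refine MonoidHom.ext fun z ↦ ?_
    induction z using QuotientGroup.induction_on with
    | _ z =>
    rw [MonoidHom.one_apply, MonoidHom.mk'_apply, hb, ← map_one χ]
    exact congrArg χ (Subtype.ext (commutatorElement_eq_one_iff_mul_comm.2
      (mem_center_iff.1 hx z).symm))

end ClassTwo

/-! ### Center, Frattini subgroup and nondegeneracy -/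

section Main

variable {p : ℕ} [Fact p.Prime] {G : Type*} [Group G] [Finite G]

/-- If all central automorphisms preserve classes, then the center of a finite `p`-group of class
two is contained in the Frattini subgroup. -/
theorem center_le_frattini (hG : IsPGroup p G) (hc : commutator G ≤ center G)
    (hA : AutClassPreserving G = Autcent G) {u : G} (hu : u ∈ commutator G)
    (hpu : p ∣ orderOf u) : center G ≤ frattini G := by
  intro z hz
  simp only [frattini, Order.radical, mem_iInf]
  intro M hM
  by_contra hzM
  have := hG.normal_of_isCoatom hM
  have hcM := hG.commutator_le_of_isCoatom hM
  have hexp : Monoid.exponent (G ⧸ M) ∣ orderOf u :=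
    (hG.card_quotient_of_isCoatom hM ▸ Group.exponent_dvd_nat_card).trans hpu
  obtain ⟨f, hfu, hfM, hfz⟩ := exists_hom_zpowers_apply_ne_one hcM hexp hzM
  have hfc : ∀ g, f g ∈ commutator G := fun g ↦ zpowers_le_of_mem hu (hfu g)
  -- A commutator with the central element `z⁻¹` is trivial, contradicting `f z ≠ 1`.
  obtain ⟨h, hh⟩ := exists_eq_commutatorElement_of_hom hA f (fun g ↦ hc (hfc g))
    (fun g ↦ hfM _ (hcM (hfc g))) z
  exact hfz (hh.trans (commutatorElement_eq_one_iff_mul_comm.2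
    (mem_center_iff.1 (inv_mem hz) h).symm))

/-- If all central automorphisms preserve classes, then a character of the center that is faithful
on a large enough cyclic subgroup makes the commutator pairing nondegenerate. -/
theorem exists_commutator_apply_ne_one (hc : commutator G ≤ center G)
    (hA : AutClassPreserving G = Autcent G) {u : G} (hu : u ∈ center G)
    (hexp : Monoid.exponent (G ⧸ center G) ∣ orderOf u) (χ : center G →* ℂˣ)
    (hχ : ∀ v : center G, (v : G) ∈ zpowers u → χ v = 1 → v = 1) {x : G} (hx : x ∉ center G) :
    ∃ y, χ ⟨⁅x, y⁆, hc (commutatorElement_mem_commutator x y)⟩ ≠ 1 := by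
  -- Working at `x⁻¹` cancels the inverse in `f g = ⁅g⁻¹, h⁆`.
  have hx' : x⁻¹ ∉ center G := fun h ↦ hx (inv_mem_iff.1 h)
  obtain ⟨f, hfu, hfZ, hfx⟩ := exists_hom_zpowers_apply_ne_one hc hexp hx'
  have hfc : ∀ g, f g ∈ center G := fun g ↦ zpowers_le_of_mem hu (hfu g)
  obtain ⟨y, hy⟩ := exists_eq_commutatorElement_of_hom hA f hfc (fun g ↦ hfZ _ (hfc g)) x⁻¹
  rw [inv_inv] at hy
  refine ⟨y, fun h ↦ hfx ?_⟩
  have := hχ _ (hy ▸ hfu x⁻¹ : ⁅x, y⁆ ∈ zpowers u) h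
  exact hy.trans (congrArg Subtype.val this)

/-- A finite abelian group has a complex character faithful on any given cyclic `p`-subgroup. -/
theorem exists_character_faithful_on_zpowers {A : Type*} [CommGroup A] [Finite A] {u : A} {m : ℕ}
    (hu : orderOf u = p ^ (m + 1)) :
    ∃ χ : A →* ℂˣ, ∀ v ∈ zpowers u, χ v = 1 → v = 1 := by
  have hne : u ^ p ^ m ≠ 1 := fun h ↦ by
    have h1 := orderOf_dvd_of_pow_eq_one h
    rw [hu, Nat.pow_dvd_pow_iff_le_right (Fact.out : p.Prime).one_lt] at h1
    omega
  -- `u ^ p ^ m` generates the unique minimal subgroup of `⟨u⟩`, so being nontrivial there is being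
  -- faithful.
  obtain ⟨χ, hχ⟩ := CommGroup.exists_apply_ne_one_of_hasEnoughRootsOfUnity A ℂ hne
  have hord : orderOf (χ u) = p ^ (m + 1) := by
    refine orderOf_eq_prime_pow (by rwa [map_pow] at hχ) ?_
    rw [← map_pow, ← hu, pow_orderOf_eq_one, map_one]
  refine ⟨χ, ?_⟩
  rintro _ ⟨k, rfl⟩ hk
  rw [map_zpow, ← orderOf_dvd_iff_zpow_eq_one, hord, ← hu, orderOf_dvd_iff_zpow_eq_one] at hk
  exact hk

end Main

theorem theoremB (p : ℕ) [Fact p.Prime] (G : Type*) [Group G] [Finite G]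
    (hG : IsPGroup p G) (hclass : Group.nilpotencyClass G = 2)
    (hA : AutClassPreserving G = Autcent G) :
    Even (Group.rank G) := by
  have hnil : Group.IsNilpotent G := hG.isNilpotent
  have hc := commutator_le_center_of_nilpotencyClass_le_two hclass.le
  let _ : CommGroup (commutator G) :=
    { mul_comm := fun a b ↦ Subtype.ext (mem_center_iff.1 (hc b.2) a) }
  obtain ⟨⟨u, huG⟩, hu⟩ := Monoid.exists_orderOf_eq_exponent
    (Monoid.ExponentExists.of_finite (G := commutator G))
  rw [Subgroup.orderOf_mk] at hu
  have hexp : Monoid.exponent (G ⧸ center G) ∣ orderOf u := hu ▸ exponent_quotient_center_dvd hc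
  obtain ⟨n, hn⟩ := IsPGroup.iff_orderOf.1 hG u
  obtain _ | m := n
  -- If `u = 1`, then `G` equals its center and has class at most one.
  · rw [hn, pow_zero, Nat.dvd_one, Monoid.exp_eq_one_iff,
      QuotientGroup.subsingleton_iff] at hexp
    have hle := Group.IsNilpotent.nilpotencyClass_le_one_iff.2
      (⟨⟨fun a b ↦ mem_center_iff.1 (hexp ▸ mem_top b : b ∈ center G) a⟩⟩ : IsMulCommutative G)
    omega
  have hpu : p ∣ orderOf u := hn ▸ dvd_pow_self p m.succ_ne_zero
  rw [← rank_quotient_eq_of_le_frattini _ (center_le_frattini hG hc hA huG hpu)]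
  obtain ⟨χ, hχ⟩ := exists_character_faithful_on_zpowers (p := p) (m := m)
    (u := (⟨u, hc huG⟩ : center G)) (by rw [Subgroup.orderOf_mk, hn])
  obtain ⟨B, hB⟩ := exists_pairing_quotient_center hc χ
  let _ : CommGroup (G ⧸ center G) :=
    { mul_comm := (Normal.quotient_commutative_iff_commutator_le.2 hc).is_comm.comm }
  refine even_rank_of_alternating (hG.to_quotient _) B (fun x ↦ ?_) fun x hx ↦ ?_
  · induction x using QuotientGroup.induction_on with
    | _ x =>
    rw [hB, ← map_one χ]
    exact congrArg χ (Subtype.ext (commutatorElement_self x))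
  · induction x using QuotientGroup.induction_on with
    | _ x =>
    have hfaithful : ∀ v : center G, (v : G) ∈ zpowers u → χ v = 1 → v = 1 := by
      rintro v ⟨k, hk⟩
      exact hχ v ⟨k, Subtype.ext hk⟩
    obtain ⟨y, hy⟩ := exists_commutator_apply_ne_one hc hA (hc huG) hexp χ hfaithful
      (fun h ↦ hx ((QuotientGroup.eq_one_iff x).2 h))
    exact ⟨y, by rwa [hB]⟩
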